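/- Let $\mathbb T$ be the unit circle with normalized arc length, let $H^2\subset L^2(\mathbb T)$ be the Hardy space (functions whose negative Fourier coefficients vanish; equivalently, via $f(z)=\sum_{n\ge 0}\hat f(n)z^n$, holomorphic functions on the open unit disc $\mathbb D$ with square-summable Taylor coefficients), and let $\mathbb P:L^2(\mathbb T)\to H^2$ be the Riesz (orthogonal) projection. Let $\mathrm{Rat}(\mathbb T)$ be the set of complex rational functions all of whose poles in $\mathbb C$ lie on $\mathbb T$, and $\mathrm{Rat}_0(\mathbb T)$ the subset of strictly proper ones (the degree of the numerator is smaller than that of the denominator; this includes $0$). For $\omega\in\mathrm{Rat}(\mathbb T)$ let $T_\omega$ be the operator on $H^2$ with $$\mathrm{Dom}(T_\omega)=\{g\in H^2:\ \omega g=f+\rho \text{ a.e. on }\mathbb T\text{ with } f\in L^2(\mathbb T),\ \rho\in\mathrm{Rat}_0(\mathbb T)\},\qquad T_\omega g=\mathbb P f .$$ For a holomorphic function $\varphi$ on $\mathbb D$ let $T^{\mathrm{Sa}}_\varphi$ be Sarason's Toeplitz operator, with domain $\{f\in H^2:\ \varphi f\in H^2\}$ (products taken on $\mathbb D$) and $T^{\mathrm{Sa}}_\varphi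 f=\varphi f$. **Proposition 6.1.** (i) Let $\widetilde\omega=\widetilde s/\widetilde q\in\mathrm{Rat}(\mathbb T)$ with $\widetilde s,\widetilde q$ co-prime complex polynomials, $\widetilde q\neq 0$. Then $\mathrm{Dom}(T^{\mathrm{Sa}}_{\widetilde\omega})=\widetilde q H^2$ and $T^{\mathrm{Sa}}_{\widetilde\omega}=T_{\widetilde\omega}|_{\widetilde q H^2}$. (ii) Let $\omega=s/q\in\mathrm{Rat}(\mathbb T)$, with $s,q$ co-prime polynomials, be proper, i.e. $n:=\deg s\le m:=\deg q$ (or $s=0$). Let $\omega^*(z)=z^{m-n}s^\sharp(z)/q^\sharp(z)$, where $r^\sharp(z)=z^{\deg r}\,\overline{r(1/\bar z)}$ (with $\omega^*=0$ if $\omega=0$), be the rational function that equals $\overline{\omega(z)}$ for $z\in\mathbb T$ not a pole of $\omega$. Then $\omega^*\in\mathrm{Rat}(\mathbb T)$, the operator $T_\omega$ is densely defined, and its Hilbert space adjoint is $T_\omega^*=T^{\mathrm{Sa}}_{\omega^*}$ (equality of domains and of actions). -/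

import Mathlib

open MeasureTheory Polynomial

namespace HardyToeplitz

/-! ### The Hardy space `H²` of the unit circle -/

/-- `L²(𝕋)`. The unit circle `𝕋` is parametrized by `t ∈ ℝ/ℤ` through
`AddCircle.toCircle t = exp(2πit)`; the measure is normalized arc length `dθ/2π`. -/
abbrev L2T : Type := Lp ℂ 2 (AddCircle.haarAddCircle : Measure UnitAddCircle)

/-- The point of the unit circle with parameter `t`, as a complex number. -/
noncomputable def pt (t : UnitAddCircle) : ℂ := (AddCircle.toCircle t : ℂ)

theorem fourierCoeff_add' (f g : L2T) (n : ℤ) :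
    fourierCoeff (f + g : L2T) n = fourierCoeff f n + fourierCoeff g n := by
  simp_rw [← fourierBasis_repr]; simp

theorem fourierCoeff_smul' (c : ℂ) (f : L2T) (n : ℤ) :
    fourierCoeff (c • f : L2T) n = c * fourierCoeff f n := by
  simp_rw [← fourierBasis_repr]; simp

theorem fourierCoeff_zero' (n : ℤ) : fourierCoeff (0 : L2T) n = 0 := by
  rw [← fourierBasis_repr]; simp

/-- The Hardy space `H²`, as the closed subspace of `L²(𝕋)` of the functions whose Fourier
coefficients of negative index vanish. -/
noncomputable def H2 : Submodule ℂ L2T where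
  carrier := {f | ∀ n : ℤ, n < 0 → fourierCoeff f n = 0}
  add_mem' := fun {f g} hf hg n hn => by rw [fourierCoeff_add', hf n hn, hg n hn, add_zero]
  zero_mem' := fun n _ => fourierCoeff_zero' n
  smul_mem' := fun c f hf n hn => by rw [fourierCoeff_smul', hf n hn, mul_zero]

theorem isClosed_H2 : IsClosed (H2 : Set L2T) := by
  have h : (H2 : Set L2T) = ⋂ n : ℤ, ⋂ _ : n < 0, {f : L2T | fourierCoeff f n = 0} := by
    ext f; simp [H2]
  rw [h]
  refine isClosed_iInter fun n => isClosed_iInter fun _ => isClosed_eq ?_ continuous_const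
  simp_rw [← fourierBasis_repr, HilbertBasis.repr_apply_apply]
  fun_prop

instance : CompleteSpace H2 := isClosed_H2.completeSpace_coe

/-- The Riesz projection `ℙ` of `L²(𝕋)` onto `H²`, that is, the orthogonal projection. -/
noncomputable def rieszProj : L2T →L[ℂ] H2 := H2.orthogonalProjectionOnto

/-- The holomorphic function on the open unit disc `𝔻` that corresponds to `f ∈ H²`:
`f(z) = ∑_{n ≥ 0} f̂(n) zⁿ` (only used for `|z| < 1`). -/
noncomputable def disc (f : H2) (z : ℂ) : ℂ := ∑' n : ℕ, fourierCoeff (f : L2T) n * z ^ n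

theorem norm_fourierCoeff_le (f : L2T) (n : ℤ) : ‖fourierCoeff f n‖ ≤ ‖f‖ := by
  rw [← fourierBasis_repr]
  exact (lp.norm_apply_le_norm (by simp) _ _).trans (by simp)

theorem summable_disc (f : H2) {z : ℂ} (hz : ‖z‖ < 1) :
    Summable fun n : ℕ => fourierCoeff (f : L2T) n * z ^ n := by
  refine Summable.of_norm_bounded
    ((summable_geometric_of_lt_one (norm_nonneg z) hz).mul_left ‖(f : L2T)‖) fun n => ?_
  rw [norm_mul, norm_pow]
  gcongr
  exact norm_fourierCoeff_le _ _

theorem disc_add (f g : H2) {z : ℂ} (hz : ‖z‖ < 1) : disc (f + g) z = disc f z + disc g z := by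
  unfold disc
  rw [← (summable_disc f hz).tsum_add (summable_disc g hz)]
  refine tsum_congr fun n => ?_
  rw [Submodule.coe_add, fourierCoeff_add', add_mul]

theorem disc_smul (c : ℂ) (f : H2) (z : ℂ) : disc (c • f) z = c * disc f z := by
  unfold disc
  rw [← tsum_mul_left]
  refine tsum_congr fun n => ?_
  rw [Submodule.coe_smul, fourierCoeff_smul', mul_assoc]

theorem disc_zero (z : ℂ) : disc 0 z = 0 := by
  simpa using disc_smul 0 0 z

/-- An element of `H²` is determined by its values on the disc. -/
theorem eq_zero_of_disc_eq_zero (f : H2) (hf : ∀ z : ℂ, ‖z‖ < 1 → disc f z = 0) : f = 0 := by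
  have h0 : ∀ n : ℕ, fourierCoeff (f : L2T) n = 0 := by
    set p : FormalMultilinearSeries ℂ ℂ ℂ :=
      FormalMultilinearSeries.ofScalars ℂ (fun n : ℕ => fourierCoeff (f : L2T) n) with hp
    have hps : HasFPowerSeriesOnBall (disc f) p 0 1 := by
      refine ⟨?_, by norm_num, ?_⟩
      · refine ENNReal.le_of_forall_nnreal_lt fun r hr => ?_
        refine p.le_radius_of_bound ‖(f : L2T)‖ fun n => ?_
        have hr1 : (r : ℝ) ≤ 1 := by exact_mod_cast hr.le
        have : ‖p n‖ ≤ ‖(f : L2T)‖ := by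
          rw [hp, FormalMultilinearSeries.ofScalars_norm]
          exact norm_fourierCoeff_le _ _
        calc ‖p n‖ * (r : ℝ) ^ n ≤ ‖(f : L2T)‖ * 1 := by
              gcongr
              exact pow_le_one₀ r.2 hr1
          _ = _ := mul_one _
      · intro y hy
        have hy' : ‖y‖ < 1 := by
          rw [Metric.mem_eball, edist_zero_right, enorm_eq_nnnorm] at hy
          exact_mod_cast hy
        have := (summable_disc f hy').hasSum
        simpa [hp, FormalMultilinearSeries.ofScalars, disc, mul_comm] using this
    have hz : disc f =ᶠ[nhds 0] 0 := by
      filter_upwards [Metric.ball_mem_nhds (0 : ℂ) one_pos] with z hz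
      exact hf z (by simpa using hz)
    have := hps.hasFPowerSeriesAt.eq_zero_of_eventually hz
    intro n
    have h2 : p.coeff n = 0 := by rw [this]; rfl
    rw [hp, FormalMultilinearSeries.coeff_ofScalars] at h2
    exact h2
  have h1 : fourierBasis.repr (f : L2T) = 0 := by
    ext n
    rw [fourierBasis_repr]
    rcases lt_or_ge n 0 with hn | hn
    · simpa using f.2 n hn
    · obtain ⟨k, rfl⟩ := Int.eq_ofNat_of_zero_le hn
      simpa using h0 k
  exact Subtype.ext ((LinearIsometryEquiv.map_eq_zero_iff _).1 h1)

/-! ### Sarason's Toeplitz operator -/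

/-- The graph of multiplication by `φ` on `H²`: pairs `(f, g)` of elements of `H²` with
`g = φ f` on `𝔻`. -/
noncomputable def sarasonGraph (φ : ℂ → ℂ) : Submodule ℂ (H2 × H2) where
  carrier := {x | ∀ z : ℂ, ‖z‖ < 1 → disc x.2 z = φ z * disc x.1 z}
  add_mem' := fun {x y} hx hy z hz => by
    rw [Prod.snd_add, Prod.fst_add, disc_add _ _ hz, disc_add _ _ hz, hx z hz, hy z hz, mul_add]
  zero_mem' := fun z _ => by simp [disc_zero]
  smul_mem' := fun c x hx z hz => by
    rw [Prod.smul_snd, Prod.smul_fst, disc_smul, disc_smul, hx z hz]; ring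

theorem sarasonGraph_single (φ : ℂ → ℂ) (x : H2 × H2) (hx : x ∈ sarasonGraph φ)
    (h : x.1 = 0) : x.2 = 0 := by
  refine eq_zero_of_disc_eq_zero _ fun z hz => ?_
  rw [hx z hz, h, disc_zero, mul_zero]

/-- Sarason's Toeplitz operator with symbol `φ` (a function on `𝔻`):
the domain is `{f ∈ H² : φ f ∈ H²}`, and `f` is mapped to `φ f`. -/
noncomputable def sarason (φ : ℂ → ℂ) : H2 →ₗ.[ℂ] H2 := (sarasonGraph φ).toLinearPMap

theorem mem_sarason_domain (φ : ℂ → ℂ) (f : H2) :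
    f ∈ (sarason φ).domain ↔ ∃ g : H2, ∀ z : ℂ, ‖z‖ < 1 → disc g z = φ z * disc f z := by
  simp [sarason, Submodule.toLinearPMap_domain, sarasonGraph]

theorem disc_sarason_apply (φ : ℂ → ℂ) (f : (sarason φ).domain) (z : ℂ) (hz : ‖z‖ < 1) :
    disc (sarason φ f) z = φ z * disc f z :=
  Submodule.mem_graph_toLinearPMap (sarasonGraph_single φ) f z hz

/-! ### Rational functions -/

/-- The value of a rational function at `z` (with value `0` at the poles). -/
noncomputable def ev (ω : RatFunc ℂ) (z : ℂ) : ℂ := ω.eval (RingHom.id ℂ) z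

/-- All roots of `p` lie on the unit circle. -/
def RootsOnCircle (p : ℂ[X]) : Prop := ∀ z : ℂ, p.IsRoot z → ‖z‖ = 1

/-- `Rat(𝕋)`: rational functions all of whose poles (in `ℂ`) lie on the unit circle. -/
def RatT : Set (RatFunc ℂ) := {ω | RootsOnCircle ω.denom}

/-- `Rat₀(𝕋)`: the strictly proper functions in `Rat(𝕋)`. -/
def Rat0T : Set (RatFunc ℂ) := {ω | ω ∈ RatT ∧ ω.num.degree < ω.denom.degree}

/-- A rational function is proper if the degree of its numerator is at most the degree of its
denominator. -/
def IsProper (ω : RatFunc ℂ) : Prop := ω.num.degree ≤ ω.denom.degree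

/-- `r^♯(z) = z^k * conj (r (1 / conj z))` for a polynomial `r` of degree `k`: the polynomial with
the conjugated coefficients in reversed order. -/
noncomputable def sharp (r : ℂ[X]) : ℂ[X] := (r.map (starRingEnd ℂ)).reverse

/-- The rational function `ω^*` with `ω^* = conj ω` on the unit circle, namely
`ω^* = z^(m-n) s^♯ / q^♯` where `ω = s / q` in lowest terms, `n = deg s`, `m = deg q`. -/
noncomputable def ratStar (ω : RatFunc ℂ) : RatFunc ℂ :=
  algebraMap ℂ[X] (RatFunc ℂ) (X ^ ω.denom.natDegree * sharp ω.num) /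
    algebraMap ℂ[X] (RatFunc ℂ) (X ^ ω.num.natDegree * sharp ω.denom)

theorem eval_sharp (r : ℂ[X]) {z : ℂ} (hz : ‖z‖ = 1) :
    (sharp r).eval z = z ^ r.natDegree * (starRingEnd ℂ) (r.eval z) := by
  have hz0 : z ≠ 0 := by rintro rfl; simp at hz
  let i : Invertible z⁻¹ := invertibleOfNonzero (inv_ne_zero hz0)
  have h := eval₂_reverse_mul_pow (RingHom.id ℂ) z⁻¹ (r.map (starRingEnd ℂ))
  have e : (⅟ (z⁻¹) : ℂ) = z := by simp
  have hc : (starRingEnd ℂ) z = z⁻¹ := by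
    rw [Complex.inv_def, Complex.normSq_eq_norm_sq, hz]; simp
  rw [e, natDegree_map, ← hc, eval₂_id, eval₂_id, eval_map, eval₂_hom] at h
  rw [sharp, ← h, hc, inv_pow]
  field_simp

/-- The defining property of `ω^*`: it is the complex conjugate of `ω` on the unit circle
(away from the poles of `ω`). -/
theorem ev_ratStar (ω : RatFunc ℂ) {z : ℂ} (hz : ‖z‖ = 1) (hd : ω.denom.eval z ≠ 0) :
    ev (ratStar ω) z = (starRingEnd ℂ) (ev ω z) := by
  have hz0 : z ≠ 0 := by rintro rfl; simp at hz
  set a : ℂ[X] := X ^ ω.denom.natDegree * sharp ω.num with ha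
  set b : ℂ[X] := X ^ ω.num.natDegree * sharp ω.denom with hb
  have hbz : b.eval z ≠ 0 := by
    rw [hb, eval_mul, eval_sharp _ hz]
    simp [hz0, hd]
  have hb0 : b ≠ 0 := by rintro h; simp [h] at hbz
  have hdz : eval₂ (RingHom.id ℂ) z (ratStar ω).denom ≠ 0 := by
    rw [eval₂_id]
    intro h
    exact hbz (eval_eq_zero_of_dvd_of_eval_eq_zero (RatFunc.denom_div_dvd a b) h)
  have hB : ev (algebraMap ℂ[X] (RatFunc ℂ) b) z = b.eval z := by
    simp [ev, RatFunc.eval_algebraMap, eval₂_id]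
  have hA : ev (algebraMap ℂ[X] (RatFunc ℂ) a) z = a.eval z := by
    simp [ev, RatFunc.eval_algebraMap, eval₂_id]
  have hm : ratStar ω * algebraMap ℂ[X] (RatFunc ℂ) b = algebraMap ℂ[X] (RatFunc ℂ) a :=
    div_mul_cancel₀ _ (RatFunc.algebraMap_ne_zero hb0)
  have h1 : ev (ratStar ω) z * b.eval z = a.eval z := by
    rw [← hA, ← hB, ← hm, ev, ev, ev, RatFunc.eval_mul _ _ hdz (by simp)]
  have h2 : ev ω z = ω.num.eval z / ω.denom.eval z := by
    simp [ev, RatFunc.eval, eval₂_id]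
  rw [eq_div_of_mul_eq hbz h1, h2, map_div₀, ha, hb, eval_mul, eval_mul, eval_sharp _ hz,
    eval_sharp _ hz, eval_pow, eval_pow, eval_X]
  have : (starRingEnd ℂ) (ω.denom.eval z) ≠ 0 := by simpa using hd
  field_simp

theorem RootsOnCircle.of_dvd_mul {p q r : ℂ[X]} (hp : RootsOnCircle p) (hq : RootsOnCircle q)
    (h : r ∣ p * q) : RootsOnCircle r := fun z hz => by
  have h1 : (p * q).IsRoot z := hz.dvd h
  rcases root_mul.1 h1 with h | h
  exacts [hp z h, hq z h]

theorem degree_lt_of_mul_eq {a b c d : ℂ[X]} (hb : b ≠ 0) (h : a * b = c * d)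
    (hd : d ≠ 0) (hc : c.degree < b.degree) : a.degree < d.degree := by
  by_cases hc0 : c = 0
  · have : a = 0 := by simpa [hc0, hb] using h
    rw [this, degree_zero]; exact bot_lt_iff_ne_bot.2 (by simpa using hd)
  have ha0 : a ≠ 0 := by
    rintro rfl
    simp [hc0, hd] at h
  have := congrArg natDegree h
  rw [natDegree_mul ha0 hb, natDegree_mul hc0 hd] at this
  rw [degree_eq_natDegree hc0, degree_eq_natDegree hb, Nat.cast_lt] at hc
  rw [degree_eq_natDegree ha0, degree_eq_natDegree hd, Nat.cast_lt]
  omega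

theorem Rat0T_zero : (0 : RatFunc ℂ) ∈ Rat0T := by
  refine ⟨fun z hz => ?_, ?_⟩ <;> simp_all

theorem Rat0T_add {x y : RatFunc ℂ} (hx : x ∈ Rat0T) (hy : y ∈ Rat0T) : x + y ∈ Rat0T := by
  refine ⟨hx.1.of_dvd_mul hy.1 (RatFunc.denom_add_dvd x y), ?_⟩
  refine degree_lt_of_mul_eq (mul_ne_zero x.denom_ne_zero y.denom_ne_zero)
    (RatFunc.num_denom_add x y) (RatFunc.denom_ne_zero _) ?_
  refine (degree_add_le _ _).trans_lt (max_lt ?_ ?_)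
  · rw [degree_mul, degree_mul]
    exact WithBot.add_lt_add_right (by simpa using y.denom_ne_zero) hx.2
  · rw [degree_mul, degree_mul]
    exact WithBot.add_lt_add_left (by simpa using x.denom_ne_zero) hy.2

theorem Rat0T_C_mul (c : ℂ) {x : RatFunc ℂ} (hx : x ∈ Rat0T) : RatFunc.C c * x ∈ Rat0T := by
  have h1 : RootsOnCircle (RatFunc.C c).denom := fun z hz => by simp at hz
  refine ⟨h1.of_dvd_mul hx.1 (RatFunc.denom_mul_dvd _ x), ?_⟩
  refine degree_lt_of_mul_eq (mul_ne_zero (RatFunc.denom_ne_zero _) x.denom_ne_zero)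
    (RatFunc.num_denom_mul _ x) (RatFunc.denom_ne_zero _) ?_
  rw [RatFunc.num_C, RatFunc.denom_C, one_mul]
  refine lt_of_le_of_lt ?_ hx.2
  rw [degree_mul]
  calc (C c).degree + x.num.degree ≤ 0 + x.num.degree := by
        gcongr
        exact degree_C_le
    _ = _ := zero_add _

theorem ae_eval_ne_zero (p : ℂ[X]) (hp : p ≠ 0) :
    ∀ᵐ t ∂(AddCircle.haarAddCircle : Measure UnitAddCircle), p.eval (pt t) ≠ 0 := by
  have hf : {t : UnitAddCircle | p.eval (pt t) = 0}.Finite := by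
    have h1 : ({z : ℂ | p.IsRoot z}).Finite := p.finite_setOfPred_isRoot hp
    refine h1.preimage (Function.Injective.injOn ?_)
    exact Subtype.val_injective.comp (AddCircle.injective_toCircle one_ne_zero)
  have : (AddCircle.haarAddCircle : Measure UnitAddCircle)
      {t : UnitAddCircle | p.eval (pt t) = 0} = 0 := by
    have h1 : ∀ x : UnitAddCircle, volume ({x} : Set UnitAddCircle) = 0 := fun x => by
      have := AddCircle.volume_closedBall (T := 1) (x := x) 0
      simpa using this
    have h : volume {t : UnitAddCircle | p.eval (pt t) = 0} = 0 := by
      rw [← Set.biUnion_of_singleton {t : UnitAddCircle | p.eval (pt t) = 0}]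
      exact (measure_biUnion_null_iff hf.countable).2 fun x _ => h1 x
    simpa [AddCircle.volume_eq_smul_haarAddCircle] using h
  simpa [ae_iff] using this

theorem ae_ev_add (x y : RatFunc ℂ) :
    ∀ᵐ t ∂(AddCircle.haarAddCircle : Measure UnitAddCircle),
      ev (x + y) (pt t) = ev x (pt t) + ev y (pt t) := by
  filter_upwards [ae_eval_ne_zero _ x.denom_ne_zero, ae_eval_ne_zero _ y.denom_ne_zero]
    with t hx hy
  exact RatFunc.eval_add _ _ (by simpa [eval₂_id] using hx) (by simpa [eval₂_id] using hy)

theorem ae_ev_C_mul (c : ℂ) (x : RatFunc ℂ) :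
    ∀ᵐ t ∂(AddCircle.haarAddCircle : Measure UnitAddCircle),
      ev (RatFunc.C c * x) (pt t) = c * ev x (pt t) := by
  filter_upwards [ae_eval_ne_zero _ x.denom_ne_zero] with t hx
  rw [ev, RatFunc.eval_mul _ _ (by simp) (by simpa [eval₂_id] using hx), RatFunc.eval_C]
  rfl

/-- The composition of a strictly proper rational function with the parametrization of the circle
is square integrable only if the function has no poles on the circle; for a function in `Rat₀(𝕋)`
this means that it vanishes. -/
theorem eq_zero_of_mem_Rat0T {ρ : RatFunc ℂ} (hρ : ρ ∈ Rat0T) (f : L2T)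
    (hf : ∀ᵐ t ∂(AddCircle.haarAddCircle : Measure UnitAddCircle), f t = ev ρ (pt t)) :
    ρ = 0 := by
  by_cases hroot : ∃ z, ρ.denom.IsRoot z
  · exfalso
    obtain ⟨ζ, hζ⟩ := hroot
    have hζ1 := hρ.1 ζ hζ
    obtain ⟨t₀, ht₀⟩ : ∃ t : UnitAddCircle, pt t = ζ := by
      obtain ⟨t, ht⟩ := (AddCircle.homeomorphCircle (T := 1) one_ne_zero).surjective
        ⟨ζ, by simpa [Submonoid.unitSphere] using hζ1⟩
      refine ⟨t, ?_⟩
      rw [AddCircle.homeomorphCircle_apply] at ht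
      rw [pt, ht]
    obtain ⟨x₀, rfl⟩ := QuotientAddGroup.mk_surjective t₀
    let e : ℝ → ℂ := fun x => pt (x : UnitAddCircle)
    have he : e = fun x : ℝ => Complex.exp (2 * Real.pi * x * Complex.I) := by
      funext x
      have := fourier_coe_apply (T := 1) (n := 1) (x := x)
      rw [fourier_one] at this
      simp only [e, pt]
      rw [this]
      congr 1
      push_cast
      ring
    have hed : Differentiable ℝ e := by
      rw [he]
      have : Differentiable ℝ fun x : ℝ => (x : ℂ) := Complex.ofRealCLM.differentiable
      fun_prop
    have hpd : ∀ p : ℂ[X], Differentiable ℝ fun x => p.eval (e x) := fun p =>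
      (p.differentiable.restrictScalars ℝ).comp hed
    have hint : IntervalIntegrable (fun x : ℝ => ev ρ (e x)) volume
        (x₀ - 1 / 2) (x₀ - 1 / 2 + 1) := by
      rw [intervalIntegrable_iff_integrableOn_Ioc_of_le (by linarith)]
      have h1 : Integrable (fun t => ev ρ (pt t))
          (AddCircle.haarAddCircle : Measure UnitAddCircle) :=
        ((Lp.memLp f).integrable (by norm_num)).congr hf
      have h2 : Integrable (fun t => ev ρ (pt t)) (volume : Measure UnitAddCircle) := by
        rw [AddCircle.volume_eq_smul_haarAddCircle]
        simpa using h1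
      exact (AddCircle.measurePreserving_mk 1 (x₀ - 1 / 2)).integrable_comp_of_integrable h2
    refine not_intervalIntegrable_of_sub_inv_isBigO_punctured (c := x₀) ?_ (by simp)
      (by rw [Set.uIcc_of_le (by linarith)]; constructor <;> linarith) hint
    have hnum : ρ.num.eval (e x₀) ≠ 0 := by
      intro h0
      have hz : ρ.denom.eval (e x₀) = 0 := by
        simpa [e, ht₀] using hζ
      obtain ⟨u, v, huv⟩ := ρ.isCoprime_num_denom
      have := congrArg (eval (e x₀)) huv
      simp [h0, hz] at this
    have hO : (fun x => ρ.denom.eval (e x) / ρ.num.eval (e x)) =O[nhds x₀] fun x => x - x₀ := by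
      have hd : DifferentiableAt ℝ (fun x => ρ.denom.eval (e x) / ρ.num.eval (e x)) x₀ :=
        ((hpd _) x₀).div ((hpd _) x₀) hnum
      have hz : ρ.denom.eval (e x₀) = 0 := by
        simpa [e, ht₀] using hζ
      simpa [hz] using hd.isBigO_sub
    have hne : ∀ᶠ x in nhdsWithin x₀ {x₀}ᶜ, ρ.denom.eval (e x) ≠ 0 := by
      have hfin : {x : ℝ | x ∈ Set.Ico (x₀ - 1 / 2) (x₀ - 1 / 2 + 1) ∧
          ρ.denom.eval (e x) = 0}.Finite := by
        refine Set.Finite.of_injOn (f := e) (t := {z | ρ.denom.IsRoot z}) (fun x hx => hx.2) ?_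
          (ρ.denom.finite_setOfPred_isRoot ρ.denom_ne_zero)
        intro x hx y hy hxy
        have h1 : (x : UnitAddCircle) = y :=
          AddCircle.injective_toCircle one_ne_zero (Subtype.val_injective hxy)
        exact (AddCircle.coe_eq_coe_iff_of_mem_Ico hx.1 hy.1).1 h1
      have h3 := (hfin.subset (Set.sdiff_subset (t := {x₀}))).isClosed.isOpen_compl.mem_nhds
        (x := x₀) (by simp)
      have h4 : Set.Ico (x₀ - 1 / 2) (x₀ - 1 / 2 + 1) ∈ nhds x₀ :=
        Ico_mem_nhds (by linarith) (by linarith)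
      filter_upwards [nhdsWithin_le_nhds h3, nhdsWithin_le_nhds h4, self_mem_nhdsWithin]
        with x hx1 hx2 hx3 hx4
      exact hx1 ⟨⟨hx2, hx4⟩, hx3⟩
    have hne' : ∀ᶠ x in nhdsWithin x₀ {x₀}ᶜ, ρ.num.eval (e x) ≠ 0 :=
      nhdsWithin_le_nhds ((hpd ρ.num).continuous.continuousAt.eventually_ne hnum)
    have := (hO.mono nhdsWithin_le_nhds).inv_rev (l := nhdsWithin x₀ {x₀}ᶜ) ?_
    · refine this.congr_right fun x => ?_
      simp [ev, RatFunc.eval, eval₂_id]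
    · filter_upwards [hne, hne'] with x h1 h2 h3
      exact absurd h3 (div_ne_zero h1 h2)
  · have hd : ρ.denom.degree = 0 := by
      by_contra h
      exact hroot (Complex.exists_root (lt_of_le_of_ne
        (zero_le_degree_iff.2 ρ.denom_ne_zero) (Ne.symm h)))
    have := hρ.2
    rw [hd, Nat.WithBot.lt_zero_iff, degree_eq_bot] at this
    exact RatFunc.num_eq_zero_iff.1 this

/-! ### The Toeplitz-like operator -/

/-- The graph of the Toeplitz-like operator with symbol `ω`: pairs `(g, ℙ f)` with `g ∈ H²`,
`f ∈ L²(𝕋)` and `ω g = f + ρ` (almost everywhere on `𝕋`) for some `ρ ∈ Rat₀(𝕋)`. -/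
noncomputable def toeplitzGraph (ω : RatFunc ℂ) : Submodule ℂ (H2 × H2) where
  carrier := {x | ∃ f : L2T, ∃ ρ ∈ Rat0T,
    (∀ᵐ t ∂(AddCircle.haarAddCircle : Measure UnitAddCircle),
      ev ω (pt t) * (x.1 : L2T) t = f t + ev ρ (pt t)) ∧ x.2 = rieszProj f}
  add_mem' := by
    rintro x y ⟨f, ρ, hρ, h, hx⟩ ⟨f', ρ', hρ', h', hy⟩
    refine ⟨f + f', ρ + ρ', Rat0T_add hρ hρ', ?_, by simp [hx, hy]⟩
    rw [Prod.fst_add, Submodule.coe_add]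
    filter_upwards [h, h', ae_ev_add ρ ρ', Lp.coeFn_add f f',
      Lp.coeFn_add (x.1 : L2T) (y.1 : L2T)] with t h1 h2 h3 h4 h5
    rw [h3, h4, h5, Pi.add_apply, Pi.add_apply, mul_add, h1, h2]
    ring
  zero_mem' := by
    refine ⟨0, 0, Rat0T_zero, ?_, by simp⟩
    rw [Prod.fst_zero, Submodule.coe_zero]
    filter_upwards [Lp.coeFn_zero ℂ 2 (AddCircle.haarAddCircle : Measure UnitAddCircle)]
      with t h1
    rw [h1]
    simp [ev]
  smul_mem' := by
    rintro c x ⟨f, ρ, hρ, h, hx⟩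
    refine ⟨c • f, RatFunc.C c * ρ, Rat0T_C_mul c hρ, ?_, by simp [hx]⟩
    rw [Prod.smul_fst, Submodule.coe_smul]
    filter_upwards [h, ae_ev_C_mul c ρ, Lp.coeFn_smul c f, Lp.coeFn_smul c (x.1 : L2T)]
      with t h1 h2 h3 h4
    rw [h2, h3, h4, Pi.smul_apply, Pi.smul_apply, smul_eq_mul, smul_eq_mul, mul_left_comm, h1]
    ring

theorem toeplitzGraph_single (ω : RatFunc ℂ) (x : H2 × H2) (hx : x ∈ toeplitzGraph ω)
    (h : x.1 = 0) : x.2 = 0 := by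
  obtain ⟨f, ρ, hρ, hf, hx2⟩ := hx
  rw [h, Submodule.coe_zero] at hf
  have h0 := Lp.coeFn_zero ℂ 2 (AddCircle.haarAddCircle : Measure UnitAddCircle)
  have hρ0 : ρ = 0 := by
    refine eq_zero_of_mem_Rat0T hρ (-f) ?_
    filter_upwards [hf, h0, Lp.coeFn_neg f] with t h1 h2 h3
    rw [h2, Pi.zero_apply, mul_zero] at h1
    rw [h3, Pi.neg_apply]
    linear_combination h1
  have hf0 : f = 0 := by
    refine Lp.ext ?_
    filter_upwards [hf, h0] with t h1 h2
    rw [h2, Pi.zero_apply, mul_zero, hρ0] at h1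
    rw [h2, Pi.zero_apply]
    simpa [ev] using h1.symm
  rw [hx2, hf0, map_zero]

/-- The Toeplitz-like operator `T_ω` on `H²` with rational symbol `ω`: its domain is
`{g ∈ H² : ω g = f + ρ with f ∈ L²(𝕋), ρ ∈ Rat₀(𝕋)}`, and `T_ω g = ℙ f`. -/
noncomputable def toeplitz (ω : RatFunc ℂ) : H2 →ₗ.[ℂ] H2 := (toeplitzGraph ω).toLinearPMap

theorem mem_toeplitz_domain (ω : RatFunc ℂ) (g : H2) :
    g ∈ (toeplitz ω).domain ↔ ∃ f : L2T, ∃ ρ ∈ Rat0T,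
      ∀ᵐ t ∂(AddCircle.haarAddCircle : Measure UnitAddCircle),
        ev ω (pt t) * (g : L2T) t = f t + ev ρ (pt t) := by
  rw [toeplitz, Submodule.toLinearPMap_domain]
  constructor
  · rintro ⟨x, ⟨f, ρ, hρ, h, -⟩, rfl⟩
    exact ⟨f, ρ, hρ, h⟩
  · rintro ⟨f, ρ, hρ, h⟩
    exact ⟨(g, rieszProj f), ⟨f, ρ, hρ, h, rfl⟩, rfl⟩

theorem toeplitz_apply (ω : RatFunc ℂ) (g : (toeplitz ω).domain) (f : L2T) {ρ : RatFunc ℂ}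
    (hρ : ρ ∈ Rat0T)
    (h : ∀ᵐ t ∂(AddCircle.haarAddCircle : Measure UnitAddCircle),
      ev ω (pt t) * (g : L2T) t = f t + ev ρ (pt t)) :
    toeplitz ω g = rieszProj f := by
  have h1 : ((g : H2), toeplitz ω g) ∈ toeplitzGraph ω :=
    Submodule.mem_graph_toLinearPMap (toeplitzGraph_single ω) g
  have h2 : ((g : H2), rieszProj f) ∈ toeplitzGraph ω := ⟨f, ρ, hρ, h, rfl⟩
  have h3 := toeplitzGraph_single ω _ ((toeplitzGraph ω).sub_mem h1 h2) (by simp)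
  exact sub_eq_zero.1 h3

/-- The subspace `q H²` of `H²`, for a polynomial `q`. -/
noncomputable def mulH2 (q : ℂ[X]) : Submodule ℂ H2 where
  carrier := {f | ∃ h : H2, ∀ᵐ t ∂(AddCircle.haarAddCircle : Measure UnitAddCircle),
    (f : L2T) t = q.eval (pt t) * (h : L2T) t}
  add_mem' := by
    rintro f g ⟨h, hf⟩ ⟨k, hg⟩
    refine ⟨h + k, ?_⟩
    rw [Submodule.coe_add, Submodule.coe_add]
    filter_upwards [hf, hg, Lp.coeFn_add (f : L2T) (g : L2T), Lp.coeFn_add (h : L2T) (k : L2T)]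
      with t h1 h2 h3 h4
    rw [h3, h4, Pi.add_apply, Pi.add_apply, h1, h2, mul_add]
  zero_mem' := by
    refine ⟨0, ?_⟩
    rw [Submodule.coe_zero]
    filter_upwards [Lp.coeFn_zero ℂ 2 (AddCircle.haarAddCircle : Measure UnitAddCircle)]
      with t h1
    rw [h1, Pi.zero_apply, mul_zero]
  smul_mem' := by
    rintro c f ⟨h, hf⟩
    refine ⟨c • h, ?_⟩
    rw [Submodule.coe_smul, Submodule.coe_smul]
    filter_upwards [hf, Lp.coeFn_smul c (f : L2T), Lp.coeFn_smul c (h : L2T)] with t h1 h2 h3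
    rw [h2, h3, Pi.smul_apply, Pi.smul_apply, h1, smul_eq_mul, smul_eq_mul, mul_left_comm]

end HardyToeplitz

/-!
Let `S` be the shift on `H²` and `ω = s / q` in lowest terms, with `m = deg q`. A pair `(g, v)`
lies in the graph of `T_ω` if and only if `s g - q v` is a polynomial of degree less than `m`:
if `ω g = f + ρ` then `q ρ = s g - q f` is square integrable, hence a polynomial of degree less
than `m`, and `q (f - ℙ f)` has no Fourier coefficients of index `≥ m`. Since `(S*) ^ m` kills
exactly the polynomials of degree less than `m`, this says `(S*) ^ m s(S) g = (S*) ^ m q(S) v`.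

For `p` of degree at most `m` put `p♭(z) = z ^ m * conj (p (1 / conj z))`. As `S* S = 1`,
`(S*) ^ m p(S) = (p♭(S))*`, so the graph of `T_ω` is the adjoint of the subspace
`{(q♭ k, s♭ k) : k ∈ H²}`. By coprimality of `s♭` and `q♭` this is the graph of Sarason's
operator with symbol `s♭ / q♭ = ω*`. That graph is closed, so taking adjoints once more gives
`T_ω* = T^Sa_{ω*}`. The same description of the graph of Sarason's operator for `s / q` itself
gives the first part, and `T_ω` is densely defined because `q(S)` has dense range when `q` has no
zeros in the open unit disc.
-/

namespace HardyToeplitz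

/-! ### Graphs and adjoints of unbounded operators -/

section Graphs

theorem eq_domRestrict_of_le {R E F : Type*} [Ring R] [AddCommGroup E] [Module R E]
    [AddCommGroup F] [Module R F] {f g : E →ₗ.[R] F} (h : f ≤ g) : f = g.domRestrict f.domain := by
  refine LinearPMap.eq_of_le_of_domain_eq ⟨le_inf le_rfl h.1, fun x y hxy => ?_⟩
    (inf_eq_left.2 h.1).symm
  exact (h.2 (y := ⟨y, y.2.2⟩) hxy).trans (LinearPMap.domRestrict_apply rfl).symm

variable {𝕜 E F G : Type*} [RCLike 𝕜] [NormedAddCommGroup E] [InnerProductSpace 𝕜 E]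
  [NormedAddCommGroup F] [InnerProductSpace 𝕜 F] [NormedAddCommGroup G] [InnerProductSpace 𝕜 G]

theorem adjoint_adjoint_of_isClosed [CompleteSpace E] [CompleteSpace F]
    {g : Submodule 𝕜 (E × F)} (hg : IsClosed (g : Set (E × F))) : g.adjoint.adjoint = g := by
  refine le_antisymm (fun x hx => ?_) fun x hx => ?_
  · let K : Submodule 𝕜 (WithLp 2 (E × F)) :=
      g.comap (WithLp.linearEquiv 2 𝕜 (E × F)).toLinearMap
    have hK : IsClosed (K : Set (WithLp 2 (E × F))) :=
      hg.preimage (WithLp.prod_continuous_ofLp 2 E F)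
    have : CompleteSpace K := hK.completeSpace_coe
    suffices WithLp.toLp 2 x ∈ Kᗮᗮ by rwa [K.orthogonal_orthogonal] at this
    refine (Submodule.mem_orthogonal _ _).2 fun w hw => ?_
    have hadj : (w.snd, -w.fst) ∈ g.adjoint := by
      refine (Submodule.mem_adjoint_iff _ _).2 fun a b hab => ?_
      have h := (Submodule.mem_orthogonal _ _).1 hw (WithLp.toLp 2 (a, b)) hab
      rw [WithLp.prod_inner_apply] at h
      rw [inner_neg_right, sub_neg_eq_add, add_comm]
      exact h
    have h := (Submodule.mem_adjoint_iff _ _).1 hx _ _ hadj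
    rw [inner_neg_left, ← neg_add', neg_eq_zero] at h
    rwa [WithLp.prod_inner_apply]
  · refine (Submodule.mem_adjoint_iff _ _).2 fun b a hba => ?_
    have h := (Submodule.mem_adjoint_iff _ _).1 hba x.1 x.2 hx
    rw [← inner_conj_symm a, ← inner_conj_symm b, ← map_sub, ← neg_sub, h, neg_zero, map_zero]

theorem mem_adjoint_range_prod [CompleteSpace E] [CompleteSpace F] [CompleteSpace G]
    (A : G →L[𝕜] E) (B : G →L[𝕜] F) {x : F × E} :
    x ∈ (LinearMap.range (A.prod B : G →ₗ[𝕜] E × F)).adjoint ↔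
      ContinuousLinearMap.adjoint B x.1 = ContinuousLinearMap.adjoint A x.2 := by
  have h : x ∈ (LinearMap.range (A.prod B : G →ₗ[𝕜] E × F)).adjoint ↔
      ∀ k : G, inner 𝕜 k (ContinuousLinearMap.adjoint B x.1) =
        inner 𝕜 k (ContinuousLinearMap.adjoint A x.2) := by
    simp [Submodule.mem_adjoint_iff, sub_eq_zero, ContinuousLinearMap.adjoint_inner_right,
      forall_comm (β := G)]
  exact h.trans ⟨ext_inner_left 𝕜, fun e k => by rw [e]⟩

end Graphs

/-! ### Reflected polynomials -/

section ConjReflect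

/-- The polynomial `z ^ m * conj (p (1 / conj z))`, for `p` of degree at most `m`: the
conjugated coefficients in reversed order. Unlike in `sharp`, the length `m` of the reflection is
not tied to the degree of `p`, which makes the reflection additive. -/
noncomputable def conjReflect {R : Type*} [CommSemiring R] [StarRing R] (m : ℕ) (p : R[X]) : R[X] :=
  reflect m (p.map (starRingEnd R))

theorem star_pow_mul_pow_of_star_mul_self {A : Type*} [Monoid A] [StarMul A] {S : A}
    (hS : star S * S = 1) (n : ℕ) : star S ^ n * S ^ n = 1 := by
  induction n with
  | zero => simp
  | succ n ih => rw [pow_succ, pow_succ', mul_assoc, ← mul_assoc (star S), hS, one_mul, ih]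

theorem star_pow_mul_aeval {R A : Type*} [CommSemiring R] [StarRing R] [Semiring A] [StarRing A]
    [Algebra R A] [StarModule R A] {S : A} (hS : star S * S = 1) {m : ℕ} {p : R[X]}
    (hp : p.natDegree ≤ m) : star S ^ m * aeval S p = star (aeval S (conjReflect m p)) := by
  refine induction_with_natDegree_le
    (fun p => star S ^ m * aeval S p = star (aeval S (conjReflect m p))) m ?_ ?_ ?_ p hp
  · simp [conjReflect]
  · intro n c _ hn
    calc star S ^ m * aeval S (C c * X ^ n)
        = c • (star S ^ (m - n) * (star S ^ n * S ^ n)) := by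
          rw [← mul_assoc, ← pow_add, Nat.sub_add_cancel hn]
          rw [map_mul, aeval_C, map_pow, aeval_X, ← Algebra.smul_def, mul_smul_comm]
      _ = star (aeval S (conjReflect m (C c * X ^ n))) := by
          rw [star_pow_mul_pow_of_star_mul_self hS, mul_one, conjReflect, Polynomial.map_mul,
            Polynomial.map_pow, map_C, map_X, reflect_C_mul_X_pow, revAt_le hn]
          simp [starRingEnd_apply, ← Algebra.commutes, ← Algebra.smul_def]
  · intro p q _ _ hp hq
    simp only [conjReflect, Polynomial.map_add, reflect_add, map_add, star_add, mul_add] at hp hq ⊢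
    rw [hp, hq]

variable {K : Type*} [Field K] [StarRing K]

theorem eval_conjReflect {p : K[X]} {m : ℕ} (hp : p.natDegree ≤ m) {z : K} (hz : z ≠ 0) :
    (conjReflect m p).eval z = z ^ m * starRingEnd K (p.eval (starRingEnd K z)⁻¹) := by
  let _ : Invertible z⁻¹ := invertibleOfNonzero (inv_ne_zero hz)
  have hinv : ⅟ z⁻¹ = z := by simp
  have h := eval₂_reflect_mul_pow (RingHom.id K) z⁻¹ m (p.map (starRingEnd K))
    (natDegree_map_le.trans hp)
  have hmap : eval z⁻¹ (p.map (starRingEnd K)) = starRingEnd K (p.eval (starRingEnd K z)⁻¹) := by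
    rw [← eval₂_hom, map_inv₀, starRingEnd_self_apply, eval_map]
  rw [hinv, eval₂_id, eval₂_id, hmap] at h
  rw [conjReflect, ← h, mul_left_comm, ← mul_pow, mul_inv_cancel₀ hz, one_pow, mul_one]

theorem eval_zero_conjReflect (m : ℕ) (p : K[X]) :
    (conjReflect m p).eval 0 = starRingEnd K (p.coeff m) := by
  rw [← coeff_zero_eq_eval_zero, conjReflect, coeff_reflect, revAt_zero, coeff_map]

variable {s q : K[X]}

theorem conjReflect_natDegree_eval_zero_ne_zero (hq : q ≠ 0) :
    (conjReflect q.natDegree q).eval 0 ≠ 0 := by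
  rw [eval_zero_conjReflect]
  exact (_root_.map_ne_zero _).2 (leadingCoeff_ne_zero.2 hq)

theorem isCoprime_conjReflect [IsAlgClosed K] (hq : q ≠ 0)
    (hs : s.natDegree ≤ q.natDegree) (h : IsCoprime s q) :
    IsCoprime (conjReflect q.natDegree s) (conjReflect q.natDegree q) := by
  rw [isCoprime_iff_aeval_ne_zero_of_isAlgClosed K K] at h ⊢
  simp only [coe_aeval_eq_eval] at h ⊢
  intro z
  obtain rfl | hz := eq_or_ne z 0
  · exact .inr (conjReflect_natDegree_eval_zero_ne_zero hq)
  · rw [eval_conjReflect hs hz, eval_conjReflect le_rfl hz]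
    simpa [hz] using h (starRingEnd K z)⁻¹

theorem rootsOnCircle_conjReflect {q : ℂ[X]} (hq : q ≠ 0) (h : RootsOnCircle q) :
    RootsOnCircle (conjReflect q.natDegree q) := by
  intro z hroot
  have hz : z ≠ 0 := by
    rintro rfl
    exact conjReflect_natDegree_eval_zero_ne_zero hq hroot
  rw [IsRoot.def, eval_conjReflect le_rfl hz] at hroot
  simpa using h (starRingEnd ℂ z)⁻¹ (by simpa [hz] using hroot)

theorem X_pow_mul_conjReflect {p : ℂ[X]} {m : ℕ} (hp : p.natDegree ≤ m) :
    X ^ p.natDegree * conjReflect m p = X ^ m * sharp p := by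
  have hsplit : conjReflect m p = X ^ (m - p.natDegree) * sharp p := by
    have h := reflect_mul (1 : ℂ[X]) (p.map (starRingEnd ℂ)) (F := m - p.natDegree)
      (G := p.natDegree) (by simp) natDegree_map_le
    rw [Nat.sub_add_cancel hp, one_mul, reflect_one] at h
    rw [conjReflect, h, sharp, reverse, natDegree_map]
  rw [hsplit, ← mul_assoc, ← pow_add, Nat.add_sub_cancel' hp]

theorem ratStar_eq {ω : RatFunc ℂ} (hω : IsProper ω) :
    ratStar ω = algebraMap ℂ[X] (RatFunc ℂ) (conjReflect ω.denom.natDegree ω.num) /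
      algebraMap ℂ[X] (RatFunc ℂ) (conjReflect ω.denom.natDegree ω.denom) := by
  have hX : algebraMap ℂ[X] (RatFunc ℂ) (X ^ ω.num.natDegree) ≠ 0 :=
    RatFunc.algebraMap_ne_zero (pow_ne_zero _ X_ne_zero)
  have hden : sharp ω.denom = conjReflect ω.denom.natDegree ω.denom := by
    rw [sharp, reverse, natDegree_map, conjReflect]
  rw [ratStar, ← X_pow_mul_conjReflect (natDegree_le_natDegree hω), hden, map_mul, map_mul,
    mul_div_mul_left _ _ hX]

end ConjReflect

/-! ### The shift on `H²` -/

theorem norm_pt (t : UnitAddCircle) : ‖pt t‖ = 1 := Circle.norm_coe _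

theorem pt_pow (t : UnitAddCircle) (k : ℕ) : pt t ^ k = fourier k t := by
  rw [fourier_apply, pt, ← Circle.coe_pow, ← AddCircle.toCircle_nsmul, natCast_zsmul]

theorem fourierCoeff_pt_pow_mul (f : UnitAddCircle → ℂ) (k : ℕ) (n : ℤ) :
    fourierCoeff (fun t => pt t ^ k * f t) n = fourierCoeff f (n - k) := by
  simp_rw [fourierCoeff]
  congr 1 with t
  rw [pt_pow, smul_eq_mul, smul_eq_mul, ← mul_assoc, ← fourier_add, neg_sub, sub_eq_neg_add]

theorem fourierCoeff_eval_pt_mul {f : UnitAddCircle → ℂ}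
    (hf : Integrable f AddCircle.haarAddCircle) (p : ℂ[X]) (n : ℤ) :
    fourierCoeff (fun t => p.eval (pt t) * f t) n =
      p.sum fun k a => a * fourierCoeff f (n - k) := by
  have hterm (k : ℕ) :
      Integrable (fun t => p.coeff k * (pt t ^ k * f t)) AddCircle.haarAddCircle := by
    simp_rw [pt_pow]
    exact (hf.bdd_mul (fourier k).continuous.aestronglyMeasurable
      (.of_forall fun t => (Circle.norm_coe _).le)).const_mul _
  have hsum : (fun t => p.eval (pt t) * f t) =
      ∑ k ∈ p.support, fun t => p.coeff k * (pt t ^ k * f t) := by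
    funext t
    simp [eval_eq_sum, Polynomial.sum, Finset.sum_mul, mul_assoc]
  rw [hsum, fourierCoeff.sum _ _ fun k _ => hterm k, Finset.sum_apply, Polynomial.sum]
  simp_rw [fourierCoeff.const_mul, fourierCoeff_pt_pow_mul]

theorem ext_H2 {f g : H2} (h : ∀ n : ℕ, fourierCoeff (f : L2T) n = fourierCoeff (g : L2T) n) :
    f = g := by
  refine Subtype.ext (fourierBasis.repr.injective (lp.ext (funext fun n => ?_)))
  rw [fourierBasis_repr, fourierBasis_repr]
  obtain hn | hn := lt_or_ge n 0
  · rw [f.2 n hn, g.2 n hn]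
  · lift n to ℕ using hn
    exact h n

theorem tendsto_fourierCoeff_atTop (f : L2T) :
    Filter.Tendsto (fun n : ℕ => ‖fourierCoeff f n‖) Filter.atTop (nhds 0) := by
  have h := ((hasSum_sq_fourierCoeff f).summable.comp_injective
    Nat.cast_injective).tendsto_atTop_zero.sqrt
  simpa using h

/-- Multiplication by the coordinate function `z` on `L²(𝕋)`. -/
noncomputable def bilateralShift : L2T →L[ℂ] L2T :=
  ContinuousLinearMap.holderL AddCircle.haarAddCircle ⊤ 2 2 (ContinuousLinearMap.mul ℂ ℂ)
    (fourierLp ⊤ 1)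

theorem coeFn_bilateralShift (f : L2T) :
    bilateralShift f =ᵐ[AddCircle.haarAddCircle] fun t => pt t * f t := by
  filter_upwards [ContinuousLinearMap.coeFn_holder (r := 2) (ContinuousLinearMap.mul ℂ ℂ)
    (fourierLp ⊤ 1) f, coeFn_fourierLp (T := 1) ⊤ 1] with t h1 h2
  rw [← pow_one (pt t), pt_pow, Nat.cast_one, ← h2]
  exact h1

theorem norm_bilateralShift (f : L2T) : ‖bilateralShift f‖ = ‖f‖ := by
  rw [Lp.norm_def, Lp.norm_def]
  refine congrArg ENNReal.toReal (eLpNorm_congr_norm_ae ?_)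
  filter_upwards [coeFn_bilateralShift f] with t h
  rw [h, norm_mul, norm_pt, one_mul]

theorem fourierCoeff_bilateralShift (f : L2T) (n : ℤ) :
    fourierCoeff (bilateralShift f) n = fourierCoeff f (n - 1) := by
  rw [fourierCoeff_congr_ae (coeFn_bilateralShift f)]
  simpa only [pow_one, Nat.cast_one] using fourierCoeff_pt_pow_mul f 1 n

/-- The unilateral shift: multiplication by the coordinate function `z` on `H²`. -/
noncomputable def shift : H2 →L[ℂ] H2 :=
  (bilateralShift ∘L H2.subtypeL).codRestrict H2 fun f n hn =>
    (fourierCoeff_bilateralShift f n).trans (f.2 _ (by lia))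

theorem star_shift_mul_shift : star shift * shift = 1 :=
  (ContinuousLinearMap.norm_map_iff_adjoint_comp_self shift).1 fun f =>
    norm_bilateralShift (f : L2T)

theorem coeFn_aeval_shift (p : ℂ[X]) (f : H2) :
    (aeval shift p f : L2T) =ᵐ[AddCircle.haarAddCircle]
      fun t => p.eval (pt t) * (f : L2T) t := by
  induction p using Polynomial.induction_on generalizing f with
  | C a =>
    rw [aeval_C, ContinuousLinearMap.algebraMap_apply, Submodule.coe_smul]
    filter_upwards [Lp.coeFn_smul a (f : L2T)] with t h
    rw [h, eval_C]
    rfl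
  | add p q hp hq =>
    rw [map_add, add_apply, Submodule.coe_add]
    filter_upwards [Lp.coeFn_add (aeval shift p f : L2T) (aeval shift q f), hp f, hq f]
      with t h h1 h2
    rw [h, Pi.add_apply, h1, h2, eval_add, add_mul]
  | monomial n a ih =>
    rw [pow_succ, ← mul_assoc, map_mul, aeval_X, mul_apply_eq_comp]
    filter_upwards [ih (shift f), coeFn_bilateralShift (f : L2T)] with t h h1
    rw [h, eval_mul_X, mul_assoc, ← h1]
    rfl

theorem disc_shift (f : H2) {z : ℂ} (hz : ‖z‖ < 1) : disc (shift f) z = z * disc f z := by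
  have hcoeff (n : ℤ) : fourierCoeff (shift f : L2T) n = fourierCoeff (f : L2T) (n - 1) :=
    fourierCoeff_bilateralShift f n
  rw [disc, (summable_disc _ hz).tsum_eq_zero_add, disc, ← tsum_mul_left]
  simp_rw [hcoeff]
  rw [f.2 _ (by simp), zero_mul, zero_add]
  refine tsum_congr fun n => ?_
  rw [Nat.cast_add_one, add_sub_cancel_right, pow_succ']
  ring

theorem disc_aeval_shift (p : ℂ[X]) (f : H2) {z : ℂ} (hz : ‖z‖ < 1) :
    disc (aeval shift p f) z = p.eval z * disc f z := by
  induction p using Polynomial.induction_on generalizing f with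
  | C a => rw [aeval_C, ContinuousLinearMap.algebraMap_apply, disc_smul, eval_C]
  | add p q hp hq =>
    rw [map_add, add_apply, disc_add _ _ hz, hp, hq, eval_add, add_mul]
  | monomial n a ih =>
    rw [pow_succ, ← mul_assoc, map_mul, aeval_X, mul_apply_eq_comp, ih,
      disc_shift f hz, eval_mul_X, mul_assoc]

/-- The constant function `1` as an element of `H²`. -/
noncomputable def oneH2 : H2 :=
  ⟨fourierLp 2 0, fun n hn => by
    rw [fourierCoeff_congr_ae (coeFn_fourierLp 2 0), fourierCoeff_fourier,
      Pi.single_eq_of_ne hn.ne]⟩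

theorem coeFn_oneH2 : (oneH2 : L2T) =ᵐ[AddCircle.haarAddCircle] 1 := by
  filter_upwards [coeFn_fourierLp (T := 1) 2 0] with t h
  exact h.trans fourier_zero

theorem fourierCoeff_oneH2 (n : ℤ) : fourierCoeff (oneH2 : L2T) n = if n = 0 then 1 else 0 := by
  rw [oneH2, fourierCoeff_congr_ae (coeFn_fourierLp 2 0), fourierCoeff_fourier, Pi.single_apply]

theorem inner_shift_pow_oneH2 (f : H2) (n : ℕ) :
    inner ℂ ((shift ^ n) oneH2) f = fourierCoeff (f : L2T) n := by
  have h : ((shift ^ n) oneH2 : L2T) = fourierLp 2 n := by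
    refine Lp.ext ?_
    rw [← aeval_X (R := ℂ) shift, ← map_pow]
    filter_upwards [coeFn_aeval_shift (X ^ n) oneH2, coeFn_oneH2, coeFn_fourierLp (T := 1) 2 n]
      with t h1 h2 h3
    rw [h1, h2, h3, eval_pow, eval_X, Pi.one_apply, mul_one, pt_pow]
  rw [← fourierBasis_repr, HilbertBasis.repr_apply_apply, coe_fourierBasis, ← h,
    Submodule.coe_inner]

theorem fourierCoeff_star_shift (f : H2) (n : ℕ) :
    fourierCoeff (star shift f : L2T) n = fourierCoeff (f : L2T) (n + 1 : ℕ) := by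
  rw [← inner_shift_pow_oneH2, ContinuousLinearMap.star_eq_adjoint,
    ContinuousLinearMap.adjoint_inner_right, ← inner_shift_pow_oneH2, pow_succ',
    mul_apply_eq_comp]

theorem fourierCoeff_star_shift_pow (f : H2) (m n : ℕ) :
    fourierCoeff ((star shift ^ m) f : L2T) n = fourierCoeff (f : L2T) (n + m : ℕ) := by
  induction m generalizing f with
  | zero => rfl
  | succ m ih => rw [pow_succ, mul_apply_eq_comp, ih, fourierCoeff_star_shift, add_assoc]

theorem eq_shift_star_shift_add (f : H2) :
    f = shift (star shift f) + fourierCoeff (f : L2T) 0 • oneH2 := by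
  refine ext_H2 fun n => ?_
  rw [Submodule.coe_add, fourierCoeff_add', Submodule.coe_smul, fourierCoeff_smul',
    fourierCoeff_oneH2]
  have hshift : fourierCoeff (shift (star shift f) : L2T) n =
      fourierCoeff (star shift f : L2T) (n - 1) := fourierCoeff_bilateralShift _ _
  rw [hshift]
  cases n with
  | zero => simp [(star shift f).2 (-1)]
  | succ n =>
    rw [Nat.cast_add_one, add_sub_cancel_right, fourierCoeff_star_shift,
      if_neg (by exact_mod_cast n.succ_ne_zero), mul_zero, add_zero, Nat.cast_add_one]

theorem star_shift_pow_eq_zero_iff {m : ℕ} {f : H2} :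
    (star shift ^ m) f = 0 ↔ ∃ r : ℂ[X], r.degree < m ∧ f = aeval shift r oneH2 := by
  constructor
  · intro h
    induction m generalizing f with
    | zero => exact ⟨0, by simp, by simpa using h⟩
    | succ m ih =>
      rw [pow_succ, mul_apply_eq_comp] at h
      obtain ⟨r, hr, hf⟩ := ih h
      refine ⟨X * r + C (fourierCoeff (f : L2T) 0), ?_, ?_⟩
      · refine (degree_add_le _ _).trans_lt (max_lt ?_ (degree_C_le.trans_lt (by positivity)))
        rw [mul_comm, degree_mul_X, Nat.cast_add_one]
        exact WithBot.add_lt_add_right (by simp) hr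
      · rw [map_add, map_mul, aeval_X, aeval_C, add_apply,
          mul_apply_eq_comp, ← hf, ContinuousLinearMap.algebraMap_apply]
        exact eq_shift_star_shift_add f
  · rintro ⟨r, hr, rfl⟩
    refine ext_H2 fun n => ?_
    rw [fourierCoeff_star_shift_pow, Submodule.coe_zero, fourierCoeff_zero',
      fourierCoeff_congr_ae (coeFn_aeval_shift r oneH2),
      fourierCoeff_eval_pt_mul ((Lp.memLp _).integrable (by simp)), Polynomial.sum]
    refine Finset.sum_eq_zero fun k hk => ?_
    have hkm : k < m := by exact_mod_cast (le_degree_of_mem_supp k hk).trans_lt hr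
    rw [fourierCoeff_oneH2, if_neg (by lia), mul_zero]

theorem denseRange_aeval_shift_X_add_C {a : ℂ} (ha : 1 ≤ ‖a‖) :
    DenseRange (aeval shift (X + C a : ℂ[X])) := by
  suffices h : (LinearMap.range (aeval shift (X + C a : ℂ[X]) : H2 →ₗ[ℂ] H2))ᗮ = ⊥ by
    have := Submodule.topologicalClosure_eq_top_iff.2 h
    exact Submodule.dense_iff_topologicalClosure_eq_top.2 this
  refine (Submodule.eq_bot_iff _).2 fun f hf => ?_
  have hker : star shift f + starRingEnd ℂ a • f = 0 := by
    rw [ContinuousLinearMap.orthogonal_range, LinearMap.mem_ker,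
      ← ContinuousLinearMap.star_eq_adjoint] at hf
    simpa [Algebra.algebraMap_eq_smul_one] using hf
  have hrec (n : ℕ) :
      fourierCoeff (f : L2T) (n + 1 : ℕ) = -(starRingEnd ℂ a * fourierCoeff (f : L2T) n) := by
    rw [← fourierCoeff_star_shift, eq_neg_of_add_eq_zero_left hker, ← neg_smul,
      Submodule.coe_smul, fourierCoeff_smul', neg_mul]
  have hmono : Monotone fun n : ℕ => ‖fourierCoeff (f : L2T) n‖ := by
    refine monotone_nat_of_le_succ fun n => ?_
    rw [hrec, norm_neg, norm_mul, RCLike.norm_conj]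
    exact le_mul_of_one_le_left (norm_nonneg _) ha
  refine ext_H2 fun n => ?_
  rw [Submodule.coe_zero, fourierCoeff_zero', ← norm_le_zero_iff]
  exact hmono.ge_of_tendsto (tendsto_fourierCoeff_atTop f) n

theorem denseRange_aeval_shift {p : ℂ[X]} (hp : ∀ z : ℂ, ‖z‖ < 1 → p.eval z ≠ 0) :
    DenseRange (aeval shift p) := by
  have hsplits : p ∈ Submonoid.closure ({C a | a : ℂ} ∪ {X + C a | a : ℂ}) := IsAlgClosed.splits p
  induction hsplits using Submonoid.closure_induction with
  | one =>
    rw [map_one]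
    exact Function.Surjective.denseRange fun f => ⟨f, rfl⟩
  | mem x hx =>
    obtain ⟨a, rfl⟩ | ⟨a, rfl⟩ := hx
    · have ha : a ≠ 0 := by simpa using hp 0 (by simp)
      refine Function.Surjective.denseRange fun f => ⟨a⁻¹ • f, ?_⟩
      rw [aeval_C, ContinuousLinearMap.algebraMap_apply, smul_inv_smul₀ ha]
    · refine denseRange_aeval_shift_X_add_C (not_lt.1 fun ha => ?_)
      exact hp (-a) (by rwa [norm_neg]) (by simp)
  | mul p q _ _ ihp ihq =>
    simp only [eval_mul, mul_ne_zero_iff] at hp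
    rw [map_mul]
    exact (ihp fun z hz => (hp z hz).1).comp (ihq fun z hz => (hp z hz).2)
      (aeval shift p).continuous

/-! ### Rational functions on the circle -/

theorem memLp_eval_pt_mul {r : ENNReal} {f : UnitAddCircle → ℂ}
    (hf : MemLp f r AddCircle.haarAddCircle) (p : ℂ[X]) :
    MemLp (fun t => p.eval (pt t) * f t) r AddCircle.haarAddCircle := by
  have hcont : Continuous fun t => p.eval (pt t) :=
    p.continuous.comp (continuous_subtype_val.comp AddCircle.continuous_toCircle)
  obtain ⟨C, hC⟩ := isCompact_univ.exists_bound_of_continuousOn hcont.continuousOn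
  have hp : MemLp (fun t => p.eval (pt t)) ⊤ AddCircle.haarAddCircle :=
    memLp_top_of_bound hcont.aestronglyMeasurable C (.of_forall fun t => hC t (Set.mem_univ t))
  exact hf.mul hp

theorem ev_eq_div (ω : RatFunc ℂ) (z : ℂ) : ev ω z = ω.num.eval z / ω.denom.eval z := by
  simp [ev, RatFunc.eval, eval₂_id]

theorem ev_div {s q : ℂ[X]} {z : ℂ} (hz : q.eval z ≠ 0) :
    ev (algebraMap ℂ[X] (RatFunc ℂ) s / algebraMap ℂ[X] (RatFunc ℂ) q) z =
      s.eval z / q.eval z := by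
  have hq : q ≠ 0 := by rintro rfl; simp at hz
  set ω := algebraMap ℂ[X] (RatFunc ℂ) s / algebraMap ℂ[X] (RatFunc ℂ) q with hω
  have hd : ω.denom.eval z ≠ 0 := fun h =>
    hz (eval_eq_zero_of_dvd_of_eval_eq_zero (RatFunc.denom_div_dvd s q) h)
  have h := congrArg (eval z) ((RatFunc.num_mul_eq_mul_denom_iff hq).2 hω)
  rw [eval_mul, eval_mul] at h
  rw [ev_eq_div, div_eq_div_iff hd hz, h]

theorem RootsOnCircle.of_dvd {p r : ℂ[X]} (hp : RootsOnCircle p) (h : r ∣ p) :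
    RootsOnCircle r := fun z hz => hp z (hz.dvd h)

theorem RootsOnCircle.eval_ne_zero {q : ℂ[X]} (hq : RootsOnCircle q) {z : ℂ} (hz : ‖z‖ < 1) :
    q.eval z ≠ 0 := fun h => hz.ne (hq z h)

theorem div_mem_RatT {q : ℂ[X]} (hq : RootsOnCircle q) (s : ℂ[X]) :
    algebraMap ℂ[X] (RatFunc ℂ) s / algebraMap ℂ[X] (RatFunc ℂ) q ∈ RatT :=
  hq.of_dvd (RatFunc.denom_div_dvd s q)

theorem div_mem_Rat0T {r q : ℂ[X]} (hq0 : q ≠ 0) (hq : RootsOnCircle q)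
    (hr : r.degree < q.degree) :
    algebraMap ℂ[X] (RatFunc ℂ) r / algebraMap ℂ[X] (RatFunc ℂ) q ∈ Rat0T :=
  ⟨div_mem_RatT hq r, degree_lt_of_mul_eq hq0 ((RatFunc.num_mul_eq_mul_denom_iff hq0).2 rfl)
    (RatFunc.denom_ne_zero _) hr⟩

theorem rootsOnCircle_of_div_mem_RatT {s q : ℂ[X]} (hq : q ≠ 0) (hc : IsCoprime s q)
    (h : algebraMap ℂ[X] (RatFunc ℂ) s / algebraMap ℂ[X] (RatFunc ℂ) q ∈ RatT) :
    RootsOnCircle q := by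
  refine RootsOnCircle.of_dvd h (hc.symm.dvd_of_dvd_mul_left ?_)
  rw [← (RatFunc.num_mul_eq_mul_denom_iff hq).2 rfl]
  exact dvd_mul_left _ _

theorem dvd_of_memLp_eval_div {r d : ℂ[X]} (hd0 : d ≠ 0) (hd : RootsOnCircle d)
    (h : MemLp (fun t => r.eval (pt t) / d.eval (pt t)) 2 AddCircle.haarAddCircle) : d ∣ r := by
  have hrem : MemLp (fun t => r.eval (pt t) / d.eval (pt t) - (r / d).eval (pt t) * 1) 2
      AddCircle.haarAddCircle := h.sub (memLp_eval_pt_mul (memLp_const 1) _)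
  have hzero := eq_zero_of_mem_Rat0T (div_mem_Rat0T hd0 hd (degree_mod_lt r hd0)) (hrem.toLp _) ?_
  · rw [div_eq_zero_iff] at hzero
    exact EuclideanDomain.mod_eq_zero.1 (by simpa [hd0] using hzero)
  · filter_upwards [hrem.coeFn_toLp, ae_eval_ne_zero d hd0] with t h1 h2
    have hdiv := congrArg (eval (pt t)) (EuclideanDomain.div_add_mod r d)
    rw [eval_add, eval_mul] at hdiv
    rw [h1, ev_div h2]
    field_simp
    linear_combination -hdiv

theorem exists_eval_pt_eq_mul_ev {ρ : RatFunc ℂ} (hρ : ρ ∈ Rat0T) {q : ℂ[X]} (hq : q ≠ 0)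
    (hL : MemLp (fun t => q.eval (pt t) * ev ρ (pt t)) 2 AddCircle.haarAddCircle) :
    ∃ r : ℂ[X], r.degree < q.degree ∧
      ∀ᵐ t ∂AddCircle.haarAddCircle, r.eval (pt t) = q.eval (pt t) * ev ρ (pt t) := by
  obtain ⟨r, hr⟩ : ρ.denom ∣ q * ρ.num := by
    refine dvd_of_memLp_eval_div ρ.denom_ne_zero hρ.1 ?_
    simpa only [eval_mul, ev_eq_div, mul_div_assoc'] using hL
  refine ⟨r, degree_lt_of_mul_eq ρ.denom_ne_zero (by rw [mul_comm, ← hr, mul_comm]) hq hρ.2, ?_⟩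
  filter_upwards [ae_eval_ne_zero _ ρ.denom_ne_zero] with t h
  have heval := congrArg (eval (pt t)) hr
  rw [eval_mul, eval_mul] at heval
  rw [ev_eq_div, mul_div_assoc', heval, mul_div_cancel_left₀ _ h]

/-! ### Sarason's operator -/

theorem eq_of_disc_eq {f g : H2} (h : ∀ z : ℂ, ‖z‖ < 1 → disc f z = disc g z) : f = g := by
  refine sub_eq_zero.1 (eq_zero_of_disc_eq_zero _ fun z hz => ?_)
  rw [sub_eq_add_neg, ← neg_one_smul ℂ g, disc_add _ _ hz, disc_smul, h z hz]
  ring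

section Sarason

variable {s q : ℂ[X]}

theorem mem_sarasonGraph_div_iff (hq : ∀ z : ℂ, ‖z‖ < 1 → q.eval z ≠ 0) {x : H2 × H2} :
    x ∈ sarasonGraph (ev (algebraMap ℂ[X] (RatFunc ℂ) s / algebraMap ℂ[X] (RatFunc ℂ) q)) ↔
      aeval shift q x.2 = aeval shift s x.1 := by
  have hdisc (z : ℂ) (hz : ‖z‖ < 1) :
      disc x.2 z = ev (algebraMap ℂ[X] (RatFunc ℂ) s / algebraMap ℂ[X] (RatFunc ℂ) q) z *
        disc x.1 z ↔ disc (aeval shift q x.2) z = disc (aeval shift s x.1) z := by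
    rw [ev_div (hq z hz), disc_aeval_shift _ _ hz, disc_aeval_shift _ _ hz, div_mul_eq_mul_div,
      eq_div_iff (hq z hz), mul_comm]
  exact (forall₂_congr hdisc).trans ⟨eq_of_disc_eq, fun h z _ => by rw [h]⟩

theorem isClosed_sarasonGraph_div (hq : ∀ z : ℂ, ‖z‖ < 1 → q.eval z ≠ 0) :
    IsClosed (sarasonGraph
      (ev (algebraMap ℂ[X] (RatFunc ℂ) s / algebraMap ℂ[X] (RatFunc ℂ) q)) : Set (H2 × H2)) := by
  have h : IsClosed {x : H2 × H2 | aeval shift q x.2 = aeval shift s x.1} :=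
    isClosed_eq (by fun_prop) (by fun_prop)
  exact Set.ext (fun _ => mem_sarasonGraph_div_iff hq) ▸ h

theorem sarasonGraph_div_eq_range (hc : IsCoprime s q) (hq : ∀ z : ℂ, ‖z‖ < 1 → q.eval z ≠ 0) :
    sarasonGraph (ev (algebraMap ℂ[X] (RatFunc ℂ) s / algebraMap ℂ[X] (RatFunc ℂ) q)) =
      LinearMap.range ((aeval shift q).prod (aeval shift s) : H2 →ₗ[ℂ] H2 × H2) := by
  have hcomm (p r : ℂ[X]) (k : H2) :
      aeval shift p (aeval shift r k) = aeval shift r (aeval shift p k) := by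
    rw [← mul_apply_eq_comp, ← mul_apply_eq_comp, ← map_mul, ← map_mul, mul_comm]
  ext ⟨f, g⟩
  rw [mem_sarasonGraph_div_iff hq]
  constructor
  · intro h
    obtain ⟨a, b, hab⟩ := hc
    have hbezout (k : H2) :
        aeval shift a (aeval shift s k) + aeval shift b (aeval shift q k) = k := by
      simpa using congrArg (fun p => aeval shift p k) hab
    refine ⟨aeval shift a g + aeval shift b f, Prod.ext ?_ ?_⟩
    · change aeval shift q (_ + _) = f
      rw [map_add, hcomm, h, ← hcomm, hcomm q b, hcomm s a]
      exact hbezout f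
    · change aeval shift s (_ + _) = g
      rw [map_add, hcomm s a, hcomm s b, ← h]
      exact hbezout g
  · rintro ⟨k, hk⟩
    obtain ⟨rfl, rfl⟩ := Prod.ext_iff.1 hk
    exact hcomm q s k

theorem graph_sarason (φ : ℂ → ℂ) : (sarason φ).graph = sarasonGraph φ :=
  Submodule.toLinearPMap_graph_eq _ (sarasonGraph_single φ)

theorem mulH2_eq_range (q : ℂ[X]) : mulH2 q = LinearMap.range (aeval shift q : H2 →ₗ[ℂ] H2) := by
  ext f
  refine exists_congr fun k => ⟨fun h => Subtype.ext (Lp.ext ?_), ?_⟩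
  · exact (coeFn_aeval_shift q k).trans (.symm h)
  · rintro rfl
    exact coeFn_aeval_shift q k

theorem domain_sarason_div (hc : IsCoprime s q) (hq : ∀ z : ℂ, ‖z‖ < 1 → q.eval z ≠ 0) :
    (sarason (ev (algebraMap ℂ[X] (RatFunc ℂ) s / algebraMap ℂ[X] (RatFunc ℂ) q))).domain =
      mulH2 q := by
  rw [sarason, Submodule.toLinearPMap_domain, sarasonGraph_div_eq_range hc hq, mulH2_eq_range,
    ← LinearMap.range_comp]
  rfl

end Sarason

/-! ### The Toeplitz-like operator and its adjoint -/

theorem graph_toeplitz (ω : RatFunc ℂ) : (toeplitz ω).graph = toeplitzGraph ω :=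
  Submodule.toLinearPMap_graph_eq _ (toeplitzGraph_single ω)

theorem rieszProj_coe (f : H2) : rieszProj (f : L2T) = f :=
  Submodule.orthogonalProjectionOnto_mem_subspace_eq_self f

theorem fourierCoeff_rieszProj (f : L2T) (n : ℕ) :
    fourierCoeff (rieszProj f : L2T) n = fourierCoeff f n := by
  have hmem : (fourierBasis (n : ℤ) : L2T) ∈ H2 := fun k hk => by
    rw [coe_fourierBasis, fourierCoeff_congr_ae (coeFn_fourierLp 2 _), fourierCoeff_fourier,
      Pi.single_eq_of_ne (by lia)]
  rw [← fourierBasis_repr, ← fourierBasis_repr, HilbertBasis.repr_apply_apply,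
    HilbertBasis.repr_apply_apply]
  exact Submodule.inner_orthogonalProjectionOnto_eq_of_mem_left ⟨_, hmem⟩ f

theorem star_shift_pow_eq_zero_of_coeFn_eq {p : ℂ[X]} {m : ℕ} (hp : p.natDegree ≤ m) {u : H2}
    {h : L2T} (hh : ∀ n : ℕ, fourierCoeff h n = 0)
    (hu : (u : L2T) =ᵐ[AddCircle.haarAddCircle] fun t => p.eval (pt t) * h t) :
    (star shift ^ m) u = 0 := by
  refine ext_H2 fun n => ?_
  rw [fourierCoeff_star_shift_pow, Submodule.coe_zero, fourierCoeff_zero',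
    fourierCoeff_congr_ae hu, fourierCoeff_eval_pt_mul ((Lp.memLp _).integrable (by simp)),
    Polynomial.sum]
  refine Finset.sum_eq_zero fun k hk => ?_
  have hkm : k ≤ m := (le_natDegree_of_mem_supp k hk).trans hp
  rw [← Nat.cast_sub (by lia), hh, mul_zero]

theorem range_prod_le_toeplitzGraph_div {q : ℂ[X]} (hq : q ≠ 0) (s : ℂ[X]) :
    LinearMap.range ((aeval shift q).prod (aeval shift s) : H2 →ₗ[ℂ] H2 × H2) ≤ toeplitzGraph
      (algebraMap ℂ[X] (RatFunc ℂ) s / algebraMap ℂ[X] (RatFunc ℂ) q) := by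
  rintro _ ⟨k, rfl⟩
  refine ⟨aeval shift s k, 0, Rat0T_zero, ?_, (rieszProj_coe _).symm⟩
  filter_upwards [coeFn_aeval_shift s k, coeFn_aeval_shift q k, ae_eval_ne_zero q hq]
    with t h1 h2 h3
  change _ * (aeval shift q k : L2T) t = _
  rw [h1, h2, ev_div h3, ev, RatFunc.eval_zero, add_zero]
  field_simp

section Toeplitz

variable {s q : ℂ[X]}

theorem star_shift_pow_eq_of_mem_toeplitzGraph_div (hq : q ≠ 0) {x : H2 × H2}
    (hx : x ∈ toeplitzGraph (algebraMap ℂ[X] (RatFunc ℂ) s / algebraMap ℂ[X] (RatFunc ℂ) q)) :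
    (star shift ^ q.natDegree) (aeval shift s x.1) =
      (star shift ^ q.natDegree) (aeval shift q x.2) := by
  obtain ⟨f, ρ, hρ, hf, hx⟩ := hx
  have hqρ : (fun t => s.eval (pt t) * (x.1 : L2T) t - q.eval (pt t) * f t)
      =ᵐ[AddCircle.haarAddCircle] fun t => q.eval (pt t) * ev ρ (pt t) := by
    filter_upwards [hf, ae_eval_ne_zero q hq] with t h hqt
    rw [ev_div hqt, div_mul_eq_mul_div, div_eq_iff hqt] at h
    linear_combination h
  obtain ⟨r, hrdeg, hr⟩ := exists_eval_pt_eq_mul_ev hρ hq <| MemLp.ae_eq hqρ <|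
    (memLp_eval_pt_mul (Lp.memLp _) s).sub (memLp_eval_pt_mul (Lp.memLp f) q)
  have hfx (n : ℕ) : fourierCoeff (f - (x.2 : L2T) : L2T) n = 0 := by
    rw [sub_eq_add_neg, ← neg_one_smul ℂ (x.2 : L2T), fourierCoeff_add', fourierCoeff_smul',
      hx, fourierCoeff_rieszProj]
    ring
  have hu : (star shift ^ q.natDegree)
      (aeval shift s x.1 - aeval shift q x.2 - aeval shift r oneH2) = 0 := by
    refine star_shift_pow_eq_zero_of_coeFn_eq le_rfl hfx ?_
    filter_upwards [hqρ, hr, Lp.coeFn_sub f (x.2 : L2T), coeFn_aeval_shift s x.1,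
      coeFn_aeval_shift q x.2, coeFn_aeval_shift r oneH2, coeFn_oneH2,
      Lp.coeFn_sub (aeval shift s x.1 - aeval shift q x.2 : L2T) (aeval shift r oneH2 : L2T),
      Lp.coeFn_sub (aeval shift s x.1 : L2T) (aeval shift q x.2 : L2T)]
      with t h1 h2 h3 h4 h5 h6 h7 h8 h9
    rw [Submodule.coe_sub, Submodule.coe_sub, h8, Pi.sub_apply, h9, Pi.sub_apply, h3,
      Pi.sub_apply, h4, h5, h6, h7, Pi.one_apply]
    linear_combination h1 - h2
  have hpoly : (star shift ^ q.natDegree) (aeval shift r oneH2) = 0 :=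
    star_shift_pow_eq_zero_iff.2 ⟨r, degree_eq_natDegree hq ▸ hrdeg, rfl⟩
  rwa [map_sub, map_sub, hpoly, sub_zero, sub_eq_zero] at hu

theorem mem_toeplitzGraph_div_of_eq_add (hq0 : q ≠ 0) (hq : RootsOnCircle q) {x : H2 × H2}
    {r : ℂ[X]} (hr : r.degree < q.degree)
    (hx : aeval shift s x.1 = aeval shift q x.2 + aeval shift r oneH2) :
    x ∈ toeplitzGraph (algebraMap ℂ[X] (RatFunc ℂ) s / algebraMap ℂ[X] (RatFunc ℂ) q) := by
  refine ⟨x.2, _, div_mem_Rat0T hq0 hq hr, ?_, (rieszProj_coe _).symm⟩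
  have hxL := congrArg (Subtype.val) hx
  rw [Submodule.coe_add] at hxL
  filter_upwards [coeFn_aeval_shift s x.1, coeFn_aeval_shift q x.2, coeFn_aeval_shift r oneH2,
    coeFn_oneH2, ae_eval_ne_zero q hq0,
    Lp.coeFn_add (aeval shift q x.2 : L2T) (aeval shift r oneH2 : L2T)] with t h1 h2 h3 h4 h5 h6
  rw [hxL, h6, Pi.add_apply, h2, h3, h4, Pi.one_apply, mul_one] at h1
  rw [ev_div h5, ev_div h5]
  field_simp
  exact h1.symm

theorem mem_toeplitzGraph_div_iff (hq0 : q ≠ 0) (hq : RootsOnCircle q) {x : H2 × H2} :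
    x ∈ toeplitzGraph (algebraMap ℂ[X] (RatFunc ℂ) s / algebraMap ℂ[X] (RatFunc ℂ) q) ↔
      (star shift ^ q.natDegree) (aeval shift s x.1) =
        (star shift ^ q.natDegree) (aeval shift q x.2) := by
  refine ⟨star_shift_pow_eq_of_mem_toeplitzGraph_div hq0, fun h => ?_⟩
  rw [← sub_eq_zero, ← map_sub] at h
  obtain ⟨r, hr, hx⟩ := star_shift_pow_eq_zero_iff.1 h
  exact mem_toeplitzGraph_div_of_eq_add hq0 hq (degree_eq_natDegree hq0 ▸ hr)
    (sub_eq_iff_eq_add'.1 hx)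

theorem toeplitzGraph_div_eq_adjoint (hq0 : q ≠ 0) (hq : RootsOnCircle q)
    (hs : s.natDegree ≤ q.natDegree) :
    toeplitzGraph (algebraMap ℂ[X] (RatFunc ℂ) s / algebraMap ℂ[X] (RatFunc ℂ) q) =
      (LinearMap.range ((aeval shift (conjReflect q.natDegree q)).prod
        (aeval shift (conjReflect q.natDegree s)) : H2 →ₗ[ℂ] H2 × H2)).adjoint := by
  have hadj {p : ℂ[X]} (hp : p.natDegree ≤ q.natDegree) (f : H2) :
      ContinuousLinearMap.adjoint (aeval shift (conjReflect q.natDegree p)) f =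
        (star shift ^ q.natDegree) (aeval shift p f) := by
    have h := star_pow_mul_aeval (A := H2 →L[ℂ] H2) star_shift_mul_shift hp
    exact (congrArg (fun T : H2 →L[ℂ] H2 => T f) h).symm
  ext x
  rw [mem_toeplitzGraph_div_iff hq0 hq, mem_adjoint_range_prod, hadj hs, hadj le_rfl]

theorem sarason_div_le_toeplitz (hc : IsCoprime s q) (hq : ∀ z : ℂ, ‖z‖ < 1 → q.eval z ≠ 0) :
    sarason (ev (algebraMap ℂ[X] (RatFunc ℂ) s / algebraMap ℂ[X] (RatFunc ℂ) q)) ≤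
      toeplitz (algebraMap ℂ[X] (RatFunc ℂ) s / algebraMap ℂ[X] (RatFunc ℂ) q) := by
  have hq0 : q ≠ 0 := by
    rintro rfl
    exact hq 0 (by simp) eval_zero
  refine LinearPMap.le_of_le_graph ?_
  rw [graph_sarason, graph_toeplitz, sarasonGraph_div_eq_range hc hq]
  exact range_prod_le_toeplitzGraph_div hq0 s

theorem dense_domain_toeplitz {ω : RatFunc ℂ} (hω : ω ∈ RatT) :
    Dense ((toeplitz ω).domain : Set H2) := by
  have hdenom (z : ℂ) (hz : ‖z‖ < 1) : ω.denom.eval z ≠ 0 := RootsOnCircle.eval_ne_zero hω hz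
  have hle := (sarason_div_le_toeplitz ω.isCoprime_num_denom hdenom).1
  rw [domain_sarason_div ω.isCoprime_num_denom hdenom, RatFunc.num_div_denom, mulH2_eq_range]
    at hle
  exact (denseRange_aeval_shift hdenom).mono hle

theorem adjoint_toeplitz {ω : RatFunc ℂ} (hω : ω ∈ RatT) (hp : IsProper ω) :
    (toeplitz ω).adjoint = sarason (ev (ratStar ω)) := by
  have hstar : RootsOnCircle (conjReflect ω.denom.natDegree ω.denom) :=
    rootsOnCircle_conjReflect ω.denom_ne_zero hω
  have hcoprime := isCoprime_conjReflect ω.denom_ne_zero (natDegree_le_natDegree hp)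
    ω.isCoprime_num_denom
  have hgraph : toeplitzGraph ω = (sarasonGraph (ev (ratStar ω))).adjoint := by
    rw [ratStar_eq hp, sarasonGraph_div_eq_range hcoprime fun _ => hstar.eval_ne_zero,
      ← toeplitzGraph_div_eq_adjoint ω.denom_ne_zero hω (natDegree_le_natDegree hp),
      RatFunc.num_div_denom]
  refine LinearPMap.eq_of_eq_graph ?_
  rw [LinearPMap.adjoint_graph_eq_graph_adjoint (dense_domain_toeplitz hω), graph_toeplitz,
    graph_sarason, hgraph, adjoint_adjoint_of_isClosed]
  rw [ratStar_eq hp]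
  exact isClosed_sarasonGraph_div fun _ => hstar.eval_ne_zero

theorem ratStar_mem_RatT {ω : RatFunc ℂ} (hω : ω ∈ RatT) (hp : IsProper ω) :
    ratStar ω ∈ RatT := by
  rw [ratStar_eq hp]
  exact div_mem_RatT (rootsOnCircle_conjReflect ω.denom_ne_zero hω) _

end Toeplitz

end HardyToeplitz

open HardyToeplitz in
theorem proposition6p1_general :
    (∀ s q : ℂ[X], IsCoprime s q → (∀ z : ℂ, ‖z‖ < 1 → q.eval z ≠ 0) →
      ∀ ω : RatFunc ℂ, ω = algebraMap ℂ[X] (RatFunc ℂ) s / algebraMap ℂ[X] (RatFunc ℂ) q →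
        (sarason (ev ω)).domain = mulH2 q ∧
        sarason (ev ω) = (toeplitz ω).domRestrict (mulH2 q)) ∧
    (∀ ω : RatFunc ℂ, ω ∈ RatT → IsProper ω →
      ratStar ω ∈ RatT ∧ Dense ((toeplitz ω).domain : Set H2) ∧
      (toeplitz ω).adjoint = sarason (ev (ratStar ω))) := by
  refine ⟨?_, fun ω hω hp =>
    ⟨ratStar_mem_RatT hω hp, dense_domain_toeplitz hω, adjoint_toeplitz hω hp⟩⟩
  rintro s q hc hq _ rfl
  have hdom := domain_sarason_div hc hq
  refine ⟨hdom, ?_⟩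
  rw [← hdom]
  exact eq_domRestrict_of_le (sarason_div_le_toeplitz hc hq)

theorem proposition6p1 :
    (∀ s q : ℂ[X], q ≠ 0 → IsCoprime s q →
      ∀ ω : RatFunc ℂ, ω = algebraMap ℂ[X] (RatFunc ℂ) s / algebraMap ℂ[X] (RatFunc ℂ) q →
        ω ∈ HardyToeplitz.RatT →
        (HardyToeplitz.sarason (HardyToeplitz.ev ω)).domain = HardyToeplitz.mulH2 q ∧
        HardyToeplitz.sarason (HardyToeplitz.ev ω) =
          (HardyToeplitz.toeplitz ω).domRestrict (HardyToeplitz.mulH2 q)) ∧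
    (∀ ω : RatFunc ℂ, ω ∈ HardyToeplitz.RatT → HardyToeplitz.IsProper ω →
      HardyToeplitz.ratStar ω ∈ HardyToeplitz.RatT ∧
      Dense ((HardyToeplitz.toeplitz ω).domain : Set HardyToeplitz.H2) ∧
      (HardyToeplitz.toeplitz ω).adjoint =
        HardyToeplitz.sarason (HardyToeplitz.ev (HardyToeplitz.ratStar ω))) :=
  proposition6p1_general.imp_left fun h s q hq hc ω hω hT => h s q hc
    (fun _ => (HardyToeplitz.rootsOnCircle_of_div_mem_RatT hq hc (hω ▸ hT)).eval_ne_zero) ω hω
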